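/- Let $\Omega$ be a $\sigma$-finite measure space. A weighted graph is a symmetric measurable function $H\colon \Omega\times\Omega\to\mathbb{R}_{\ge 0}$; it is positive semidefinite (ferromagnetic) if for all $n$ and all $x_1,\dots,x_n\in\Omega$ the matrix $(H(x_i,x_j))_{i,j}$ is positive semidefinite. For a finite simple graph $G=(V,E)$ and measurable functions $\boldsymbol\lambda=(\lambda_v\colon\Omega\to\mathbb{R}_{\ge 0})_{v\in V}$ put $$\hom_{\boldsymbol\lambda}(G,H)=\int_{\Omega^V}\prod_{uv\in E}H(x_u,x_v)\prod_{v\in V}\lambda_v(x_v)\,dx_v\in[0,\infty],$$ write $\hom_\lambda(G,H)$ if $\lambda_v=\lambda$ for all $v$, and $\hom(G,H)$ if $\lambda_v=1$ for all $v$. Let $d_v$ denote the degree of $v$ in $G$, and use the convention $0\cdot\infty=0$ in products in $[0,\infty]$. Let $H$ be a positive semidefinite weighted graph on $\Omega$. Then: 1. For every finite simple graph $G=(V,E)$ and all measurable $\lambda_v\colon\Omega\to\mathbb{R}_{\ge 0}$ $(v\in V)$, $$\hom_{\boldsymbol\lambda}(G,H)\le\prod_{v\in V}\hom_{\lambda_v}(K_{d_v+1},H)^{1/(d_v+1)}.$$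 2. In particular, $H$ is clique-maximizing: for every finite simple graph $G$, $$\hom(G,H)\le\prod_{v\in V(G)}\hom(K_{d_v+1},H)^{1/(d_v+1)}.$$ 3. Consequently, for every $d\ge 0$, the $d$-regular graph $K_{d+1}$ maximizes $\hom(G,H)^{1/|V(G)|}$ among nonempty finite $d$-regular graphs $G$: for each such $G$, $$\hom(G,H)^{1/|V(G)|}\le\hom(K_{d+1},H)^{1/(d+1)}.$$ -/

import Mathlib

open MeasureTheory
open scoped NNReal ENNReal

universe u v

/-- A weighted graph (model) on the measurable space `Ω` of colors: a symmetric, jointly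
measurable function `Ω × Ω → ℝ≥0`. The vertex weights are carried by a measure on `Ω`, which is a
separate argument of `hom` and `homWeighted`. -/
structure WeightedGraph (Ω : Type v) [MeasurableSpace Ω] where
  /-- The weight function. -/
  weight : Ω → Ω → ℝ≥0
  symm : ∀ a b, weight a b = weight b a
  measurable : Measurable (Function.uncurry weight)

namespace WeightedGraph

variable {Ω : Type v} [MeasurableSpace Ω]

/-- `H` is positive semidefinite (ferromagnetic): every matrix `(H (x i) (x j))` is positive
semidefinite. -/
def IsPosSemidef (H : WeightedGraph Ω) : Prop :=
  ∀ (n : ℕ) (x : Fin n → Ω),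
    (Matrix.of fun i j : Fin n => ((H.weight (x i) (x j) : ℝ≥0) : ℝ)).PosSemidef

/-- The weight `H (x a) (x b)` of the unordered pair `s(a, b)` under the coloring `x`. -/
def edgeWeight (H : WeightedGraph Ω) {V : Type u} (x : V → Ω) : Sym2 V → ℝ≥0 :=
  Sym2.lift ⟨fun a b => H.weight (x a) (x b), fun _ _ => H.symm _ _⟩

/-- `hom(G, H) = ∫_{Ω^V} ∏_{ab ∈ E(G)} H(x_a, x_b) dx`, with values in `[0, ∞]`. -/
noncomputable def hom (μ : Measure Ω) {V : Type u} [Fintype V]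
    (G : SimpleGraph V) [DecidableRel G.Adj] (H : WeightedGraph Ω) : ℝ≥0∞ :=
  ∫⁻ x : V → Ω, ∏ e ∈ G.edgeFinset, (H.edgeWeight x e : ℝ≥0∞) ∂(Measure.pi fun _ : V => μ)

/-- `hom_lam(G, H) = ∫_{Ω^V} ∏_{ab ∈ E(G)} H(x_a, x_b) ∏_{a ∈ V} lam_a(x_a) dx_a`, with values in
`[0, ∞]`. -/
noncomputable def homWeighted (μ : Measure Ω) {V : Type u} [Fintype V]
    (G : SimpleGraph V) [DecidableRel G.Adj] (H : WeightedGraph Ω)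
    (lam : V → Ω → ℝ≥0) : ℝ≥0∞ :=
  ∫⁻ x : V → Ω, (∏ e ∈ G.edgeFinset, (H.edgeWeight x e : ℝ≥0∞)) * ∏ a, (lam a (x a) : ℝ≥0∞)
    ∂(Measure.pi fun _ : V => μ)

/-- `H` is clique-maximizing: for all finite graphs `G`,
`hom(G, H) ≤ ∏_{a ∈ V(G)} hom(K_{d_a + 1}, H) ^ (1 / (d_a + 1))`. -/
def IsCliqueMaximizing (μ : Measure Ω) (H : WeightedGraph Ω) : Prop :=
  ∀ (V : Type u) [Fintype V] (G : SimpleGraph V) [DecidableRel G.Adj],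
    hom μ G H ≤ ∏ a : V,
      hom μ (⊤ : SimpleGraph (Fin (G.degree a + 1))) H ^ (1 / ((G.degree a : ℝ) + 1))

end WeightedGraph

/-! Write `R_n(a)` for the `n`-th root of the integral over `K_n` with weight `a` on every vertex
(`cliqueRoot`), and `h_x` for `h x`. The proof removes a vertex `w` of maximal degree. Once `w` has
color `x`, each neighbour weight `b` becomes `b * h_x`, and induction bounds the rest by a product
of clique roots. Integrating over `x` leaves a star inequality: `∫ a(x) ∏ i, R_{d_i+1}(b_i h_x) dx ≤
R_{k+1}(a) ∏ i, R_{d_i+2}(b_i)`, where `k` is the degree of `w` and every `d_i < k` by maximality.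

Hölder reduces this to equal factors, `∫ a * R_{d+1}(b h_x)^(m+1) ≤ R_{m+2}(a) * R_{d+2}(b)^(m+1)`
for `d ≤ m` (`lintegral_mul_cliqueRoot_pow_le`). If `m = d`, the left side is a clique integral with
one weight `a` and `d + 1` weights `b`. Positive semidefiniteness makes mixed clique integrals
log-convex in the number of `a`'s (`mixedCliqueInt_sq_le`): fix the colors of all but two vertices,
apply Cauchy–Schwarz for the kernel, then Cauchy–Schwarz for the outer integrals. The case `m > d`
is bootstrapped by Hölder, with a nested induction on `d` and `m`.

These arguments cancel powers of clique integrals, so they need finiteness. They are run for a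
finite measure and bounded data; truncation and monotone convergence give the general case. -/

open scoped Finset

/-! ### Hölder inequalities and log-convex sequences -/

section Holder

variable {Ω : Type v} [MeasurableSpace Ω]

/-- Cauchy–Schwarz for a weighted integral of a function dominated by a geometric mean. -/
theorem lintegral_mul_sq_le_of_sq_le (μ : Measure Ω) {w r s t : Ω → ℝ≥0∞} (hw : Measurable w)
    (hs : Measurable s) (ht : Measurable t) (h : ∀ x, r x ^ 2 ≤ s x * t x) :
    (∫⁻ x, w x * r x ∂μ) ^ 2 ≤ (∫⁻ x, w x * s x ∂μ) * ∫⁻ x, w x * t x ∂μ := by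
  have key : ∫⁻ x, w x * r x ∂μ ≤
      (∫⁻ x, w x * s x ∂μ) ^ (1 / 2 : ℝ) * (∫⁻ x, w x * t x ∂μ) ^ (1 / 2 : ℝ) := by
    refine le_trans (lintegral_mono fun x => ?_)
      (ENNReal.lintegral_mul_norm_pow_le (p := 1 / 2) (q := 1 / 2) (hw.mul hs).aemeasurable
        (hw.mul ht).aemeasurable (by norm_num) (by norm_num) (by norm_num))
    rw [← ENNReal.mul_rpow_of_nonneg _ _ (by norm_num)]
    rw [one_div, ENNReal.le_rpow_inv_iff (by norm_num)]
    have : (w x * r x) ^ (2 : ℝ) = w x * w x * (r x) ^ 2 := by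
      rw [ENNReal.rpow_two]; ring
    rw [this, Pi.mul_apply, Pi.mul_apply]
    calc w x * w x * r x ^ 2 ≤ w x * w x * (s x * t x) := by gcongr; exact h x
      _ = _ := by ring
  calc (∫⁻ x, w x * r x ∂μ) ^ 2 ≤ ((∫⁻ x, w x * s x ∂μ) ^ (1 / 2 : ℝ) *
        (∫⁻ x, w x * t x ∂μ) ^ (1 / 2 : ℝ)) ^ 2 := by gcongr
    _ = _ := by
      rw [mul_pow, ← ENNReal.rpow_mul_natCast, ← ENNReal.rpow_mul_natCast]
      norm_num

/-- Hölder's inequality with integer exponents. -/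
theorem lintegral_mul_pow_le (μ : Measure Ω) {w f q : Ω → ℝ≥0∞} (hw : Measurable w)
    (hf : Measurable f) (hq : Measurable q) (k : ℕ) :
    (∫⁻ x, w x * f x * q x ^ k ∂μ) ^ (k + 1) ≤
      (∫⁻ x, w x * f x ^ (k + 1) ∂μ) * (∫⁻ x, w x * q x ^ (k + 1) ∂μ) ^ k := by
  have hk : (0 : ℝ) < (k : ℝ) + 1 := by positivity
  have hk1 : (1 / ((k : ℝ) + 1)) + k / ((k : ℝ) + 1) = 1 := by field_simp; ring
  have key : ∫⁻ x, w x * f x * q x ^ k ∂μ ≤ (∫⁻ x, w x * f x ^ (k + 1) ∂μ) ^ (1 / ((k : ℝ) + 1)) *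
      (∫⁻ x, w x * q x ^ (k + 1) ∂μ) ^ (k / ((k : ℝ) + 1)) := by
    refine le_trans (lintegral_mono fun x => ?_)
      (ENNReal.lintegral_mul_norm_pow_le (p := 1 / ((k : ℝ) + 1)) (q := k / ((k : ℝ) + 1))
        (hw.mul (hf.pow_const _)).aemeasurable
        (hw.mul (hq.pow_const _)).aemeasurable (by positivity) (by positivity) hk1)
    simp only [Pi.mul_apply]
    rw [ENNReal.mul_rpow_of_nonneg _ _ (by positivity),
      ENNReal.mul_rpow_of_nonneg _ _ (by positivity)]
    have e1 : (f x ^ (k + 1)) ^ (1 / ((k : ℝ) + 1)) = f x := by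
      rw [← ENNReal.rpow_natCast_mul]; push_cast
      rw [mul_one_div_cancel hk.ne', ENNReal.rpow_one]
    have e2 : (q x ^ (k + 1)) ^ ((k : ℝ) / ((k : ℝ) + 1)) = q x ^ k := by
      rw [← ENNReal.rpow_natCast_mul]; push_cast
      rw [mul_div_cancel₀ _ hk.ne', ENNReal.rpow_natCast]
    have e3 : w x = w x ^ (1 / ((k : ℝ) + 1)) * w x ^ ((k : ℝ) / ((k : ℝ) + 1)) := by
      rw [← ENNReal.rpow_add_of_nonneg _ _ (by positivity) (by positivity), hk1, ENNReal.rpow_one]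
    rw [e1, e2]
    nth_rw 1 [e3]
    apply le_of_eq; ring
  calc _ ≤ ((∫⁻ x, w x * f x ^ (k + 1) ∂μ) ^ (1 / ((k : ℝ) + 1)) *
      (∫⁻ x, w x * q x ^ (k + 1) ∂μ) ^ (k / ((k : ℝ) + 1))) ^ (k + 1) := by gcongr
    _ = _ := by
      rw [mul_pow, ← ENNReal.rpow_mul_natCast, ← ENNReal.rpow_mul_natCast]
      push_cast
      rw [one_div_mul_cancel hk.ne', div_mul_cancel₀ _ hk.ne', ENNReal.rpow_one,
        ENNReal.rpow_natCast]

end Holder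

/-- A log-convex finite sequence satisfies `g 1 ^ m ≤ g 0 ^ (m - 1) * g m`. -/
theorem pow_le_of_logConvex {g : ℕ → ℝ≥0∞} {n : ℕ} (hfin : ∀ k, g k ≠ ∞)
    (hg : ∀ k < n, g (k + 1) ^ 2 ≤ g k * g (k + 2)) :
    ∀ m ≤ n, g 1 ^ (m + 1) ≤ g 0 ^ m * g (m + 1) := by
  -- The ratios `g (m + 1) / g m` are at least `g 1 / g 0`, written without division.
  have step : ∀ m ≤ n, g 1 * g m ≤ g 0 * g (m + 1) := by
    intro m
    induction m with
    | zero => intro _; rw [mul_comm]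
    | succ m ih =>
      intro hm
      rcases eq_or_ne (g (m + 1)) 0 with h0 | h0
      · simp [h0]
      rw [← ENNReal.mul_le_mul_iff_left h0 (hfin (m + 1))]
      calc g 1 * g (m + 1) * g (m + 1) = g 1 * g (m + 1) ^ 2 := by ring
        _ ≤ g 1 * (g m * g (m + 2)) := by gcongr; exact hg m (by omega)
        _ = g 1 * g m * g (m + 2) := by ring
        _ ≤ g 0 * g (m + 1) * g (m + 2) := by gcongr ?_ * _; exact ih (by omega)
        _ = _ := by ring
  intro m
  induction m with
  | zero => intro _; simp
  | succ m ih =>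
    intro hm
    calc g 1 ^ (m + 1 + 1) = g 1 ^ (m + 1) * g 1 := pow_succ _ _
      _ ≤ g 0 ^ m * g (m + 1) * g 1 := by gcongr; exact ih (by omega)
      _ = g 0 ^ m * (g 1 * g (m + 1)) := by ring
      _ ≤ g 0 ^ m * (g 0 * g (m + 1 + 1)) := mul_le_mul_right (step (m + 1) hm) _
      _ = _ := by ring

/-! ### Log-convexity of mixed clique integrals -/

section Clique

variable {Ω : Type v} [MeasurableSpace Ω]

/-- The integral over `Ωⁿ` of `∏_{i < j} h (x i) (x j) * ∏ i, a (x i)`, one variable at a time. -/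
noncomputable def cliqueInt (μ : Measure Ω) (h : Ω → Ω → ℝ≥0∞) : ℕ → (Ω → ℝ≥0∞) → ℝ≥0∞
  | 0, _ => 1
  | n + 1, a => ∫⁻ x, a x * cliqueInt μ h n (fun y => a y * h x y) ∂μ

/-- The clique integral in which `k` vertices carry the weight `a` and `l` carry the weight `b`. -/
noncomputable def mixedCliqueInt (μ : Measure Ω) (h : Ω → Ω → ℝ≥0∞) :
    ℕ → ℕ → (Ω → ℝ≥0∞) → (Ω → ℝ≥0∞) → ℝ≥0∞
  | 0, l, _, b => cliqueInt μ h l b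
  | k + 1, l, a, b =>
    ∫⁻ x, a x * mixedCliqueInt μ h k l (fun y => a y * h x y) (fun y => b y * h x y) ∂μ

/-- A measurable weight bounded by a finite constant. -/
def IsBddWeight (a : Ω → ℝ≥0∞) : Prop := Measurable a ∧ ∃ C : ℝ≥0, ∀ x, a x ≤ C

/-- A bounded symmetric measurable kernel whose bilinear form on bounded nonnegative functions
satisfies the Cauchy–Schwarz inequality. -/
structure IsCauchySchwarzKernel (μ : Measure Ω) (h : Ω → Ω → ℝ≥0∞) : Prop where
  measurable : Measurable (Function.uncurry h)
  symm : ∀ x y, h x y = h y x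
  bdd : ∃ C : ℝ≥0, ∀ x y, h x y ≤ C
  cauchySchwarz : ∀ a b, IsBddWeight a → IsBddWeight b →
    (∫⁻ x, a x * ∫⁻ y, b y * h x y ∂μ ∂μ) ^ 2 ≤
      (∫⁻ x, a x * ∫⁻ y, a y * h x y ∂μ ∂μ) * ∫⁻ x, b x * ∫⁻ y, b y * h x y ∂μ ∂μ

theorem IsBddWeight.mul {a b : Ω → ℝ≥0∞} (ha : IsBddWeight a) (hb : IsBddWeight b) :
    IsBddWeight (fun x => a x * b x) := by
  obtain ⟨ham, C, hC⟩ := ha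
  obtain ⟨hbm, D, hD⟩ := hb
  exact ⟨ham.mul hbm, C * D, fun x => by push_cast; exact mul_le_mul' (hC x) (hD x)⟩

theorem measurable_cliqueInt {μ : Measure Ω} [SFinite μ] {h : Ω → Ω → ℝ≥0∞}
    (hm : Measurable (Function.uncurry h)) (n : ℕ) {T : Type v} [MeasurableSpace T]
    {A : T → Ω → ℝ≥0∞} (hA : Measurable (Function.uncurry A)) :
    Measurable fun t => cliqueInt μ h n (A t) := by
  induction n generalizing T with
  | zero => exact measurable_const
  | succ n ih =>
    simp only [cliqueInt]
    refine Measurable.lintegral_prod_right' (f := fun p : T × Ω =>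
      A p.1 p.2 * cliqueInt μ h n (fun y => A p.1 y * h p.2 y)) (hA.mul ?_)
    refine ih (A := fun (p : T × Ω) y => A p.1 y * h p.2 y) ?_
    exact (hA.comp (by fun_prop : Measurable fun q : (T × Ω) × Ω => (q.1.1, q.2))).mul
      (hm.comp (by fun_prop : Measurable fun q : (T × Ω) × Ω => (q.1.2, q.2)))

theorem measurable_mixedCliqueInt {μ : Measure Ω} [SFinite μ] {h : Ω → Ω → ℝ≥0∞}
    (hm : Measurable (Function.uncurry h)) (k l : ℕ) {T : Type v} [MeasurableSpace T]
    {A B : T → Ω → ℝ≥0∞} (hA : Measurable (Function.uncurry A))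
    (hB : Measurable (Function.uncurry B)) :
    Measurable fun t => mixedCliqueInt μ h k l (A t) (B t) := by
  induction k generalizing T with
  | zero => exact measurable_cliqueInt hm l hB
  | succ k ih =>
    simp only [mixedCliqueInt]
    refine Measurable.lintegral_prod_right' (f := fun p : T × Ω =>
      A p.1 p.2 * mixedCliqueInt μ h k l (fun y => A p.1 y * h p.2 y)
        (fun y => B p.1 y * h p.2 y)) (hA.mul ?_)
    refine ih (A := fun (p : T × Ω) y => A p.1 y * h p.2 y)
      (B := fun (p : T × Ω) y => B p.1 y * h p.2 y) ?_ ?_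
    · exact (hA.comp (by fun_prop : Measurable fun q : (T × Ω) × Ω => (q.1.1, q.2))).mul
        (hm.comp (by fun_prop : Measurable fun q : (T × Ω) × Ω => (q.1.2, q.2)))
    · exact (hB.comp (by fun_prop : Measurable fun q : (T × Ω) × Ω => (q.1.1, q.2))).mul
        (hm.comp (by fun_prop : Measurable fun q : (T × Ω) × Ω => (q.1.2, q.2)))

theorem measurable_mul_kernel {h : Ω → Ω → ℝ≥0∞} (hm : Measurable (Function.uncurry h))
    {a : Ω → ℝ≥0∞} (ha : Measurable a) :
    Measurable (Function.uncurry fun x y => a y * h x y) :=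
  (ha.comp measurable_snd).mul hm

theorem mixedCliqueInt_zero_right (μ : Measure Ω) (h : Ω → Ω → ℝ≥0∞) (k : ℕ) (a b : Ω → ℝ≥0∞) :
    mixedCliqueInt μ h k 0 a b = cliqueInt μ h k a := by
  induction k generalizing a b with
  | zero => rfl
  | succ k ih => simp only [mixedCliqueInt, cliqueInt, ih]

/-- The recursive definition integrates the `a`-vertices first. Tonelli and the symmetry of `h`
allow a `b`-vertex to come first instead, so that vertices of either kind can be peeled off. -/
theorem mixedCliqueInt_succ_right {μ : Measure Ω} [SFinite μ] {h : Ω → Ω → ℝ≥0∞}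
    (hm : Measurable (Function.uncurry h)) (hs : ∀ x y, h x y = h y x) (k l : ℕ)
    {a b : Ω → ℝ≥0∞} (ha : Measurable a) (hb : Measurable b) :
    mixedCliqueInt μ h k (l + 1) a b =
      ∫⁻ x, b x * mixedCliqueInt μ h k l (fun y => a y * h x y) (fun y => b y * h x y) ∂μ := by
  induction k generalizing a b with
  | zero => rfl
  | succ k ih =>
    have hx : ∀ x, Measurable (h x) := fun x => hm.comp measurable_prodMk_left
    simp only [mixedCliqueInt]
    have e : ∀ c : Ω → ℝ≥0∞, Measurable c → Measurable (Function.uncurry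
        fun (p : Ω × Ω) y => c y * h p.1 y * h p.2 y) := fun c hc => by
      refine ((hc.comp measurable_snd).mul (hm.comp
        (by fun_prop : Measurable fun q : (Ω × Ω) × Ω => (q.1.1, q.2)))).mul
        (hm.comp (by fun_prop : Measurable fun q : (Ω × Ω) × Ω => (q.1.2, q.2)))
    have em := measurable_mixedCliqueInt (μ := μ) hm k l (e a ha) (e b hb)
    have em' : ∀ x, Measurable fun y => mixedCliqueInt μ h k l
        (fun z => a z * h x z * h y z) (fun z => b z * h x z * h y z) := fun x =>
      em.comp (measurable_prodMk_left (x := x))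
    calc _ = ∫⁻ x, ∫⁻ y, a x * (b y * h x y * mixedCliqueInt μ h k l
          (fun z => a z * h x z * h y z) (fun z => b z * h x z * h y z)) ∂μ ∂μ := by
          refine lintegral_congr fun x => ?_
          exact (congrArg _ (ih (ha.mul (hx x)) (hb.mul (hx x)))).trans
            (lintegral_const_mul _ ((hb.mul (hx x)).mul (em' x))).symm
      _ = ∫⁻ y, ∫⁻ x, a x * (b y * h x y * mixedCliqueInt μ h k l
          (fun z => a z * h x z * h y z) (fun z => b z * h x z * h y z)) ∂μ ∂μ := by
          apply lintegral_lintegral_swap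
          exact ((ha.comp measurable_fst).mul (((hb.comp measurable_snd).mul hm).mul
            em)).aemeasurable
      _ = _ := by
          refine lintegral_congr fun y => ?_
          rw [← lintegral_const_mul]
          · refine lintegral_congr fun x => ?_
            have e1 : ∀ c : Ω → ℝ≥0∞, (fun z => c z * h x z * h y z) =
              fun z => c z * h y z * h x z := fun c => by ext z; ring
            rw [e1 a, e1 b, hs x y]; ring
          · refine (ha.mul (hx y)).mul ?_
            have := em.comp (measurable_prodMk_right (y := y))
            have e1 : ∀ (c : Ω → ℝ≥0∞) (x : Ω), (fun z => c z * h x z * h y z) =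
              fun z => c z * h y z * h x z := fun c x => by ext z; ring
            simpa only [Function.comp_def, e1] using this

namespace IsCauchySchwarzKernel

variable {μ : Measure Ω} {h : Ω → Ω → ℝ≥0∞}

theorem isBddWeight_left (hh : IsCauchySchwarzKernel μ h) (x : Ω) : IsBddWeight (h x) :=
  ⟨hh.measurable.comp measurable_prodMk_left, hh.bdd.imp fun _ hC => hC x⟩

/-- The bound depends on the weights only through `A` and `B`, so it is uniform over the reweighted
functions `a * h x` produced by the recursion. -/
theorem exists_mixedCliqueInt_le [IsFiniteMeasure μ] (hh : IsCauchySchwarzKernel μ h) (k l : ℕ)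
    (A B : ℝ≥0) : ∃ D : ℝ≥0, ∀ a b : Ω → ℝ≥0∞, (∀ x, a x ≤ A) → (∀ x, b x ≤ B) →
      mixedCliqueInt μ h k l a b ≤ D := by
  obtain ⟨C, hC⟩ := hh.bdd
  have hl : ∀ B : ℝ≥0, ∃ D : ℝ≥0, ∀ b : Ω → ℝ≥0∞, (∀ x, b x ≤ B) → cliqueInt μ h l b ≤ D := by
    induction l with
    | zero => exact fun _ => ⟨1, fun _ _ => le_rfl⟩
    | succ l ih =>
      intro B
      obtain ⟨D, hD⟩ := ih (B * C)
      refine ⟨B * D * (μ Set.univ).toNNReal, fun b hb => ?_⟩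
      push_cast
      rw [ENNReal.coe_toNNReal (measure_ne_top _ _), ← lintegral_const]
      refine lintegral_mono fun x => mul_le_mul' (hb x) (hD _ fun y => ?_)
      push_cast
      exact mul_le_mul' (hb y) (hC x y)
  induction k generalizing A B with
  | zero =>
    obtain ⟨D, hD⟩ := hl B
    exact ⟨D, fun a b _ hb => hD b hb⟩
  | succ k ih =>
    obtain ⟨D, hD⟩ := ih (A * C) (B * C)
    refine ⟨A * D * (μ Set.univ).toNNReal, fun a b ha hb => ?_⟩
    push_cast
    rw [ENNReal.coe_toNNReal (measure_ne_top _ _), ← lintegral_const]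
    refine lintegral_mono fun x => mul_le_mul' (ha x) (hD _ _ (fun y => ?_) fun y => ?_)
    · push_cast
      exact mul_le_mul' (ha y) (hC x y)
    · push_cast
      exact mul_le_mul' (hb y) (hC x y)

theorem exists_cliqueInt_le [IsFiniteMeasure μ] (hh : IsCauchySchwarzKernel μ h) (n : ℕ)
    (A : ℝ≥0) : ∃ D : ℝ≥0, ∀ a : Ω → ℝ≥0∞, (∀ x, a x ≤ A) → cliqueInt μ h n a ≤ D := by
  obtain ⟨D, hD⟩ := hh.exists_mixedCliqueInt_le 0 n 0 A
  exact ⟨D, fun a ha => hD 0 a (fun _ => zero_le) ha⟩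

theorem mixedCliqueInt_ne_top [IsFiniteMeasure μ] (hh : IsCauchySchwarzKernel μ h) (k l : ℕ)
    {a b : Ω → ℝ≥0∞} (ha : IsBddWeight a) (hb : IsBddWeight b) :
    mixedCliqueInt μ h k l a b ≠ ∞ := by
  obtain ⟨-, A, hA⟩ := ha
  obtain ⟨-, B, hB⟩ := hb
  obtain ⟨D, hD⟩ := hh.exists_mixedCliqueInt_le k l A B
  exact ne_top_of_le_ne_top ENNReal.coe_ne_top (hD a b hA hB)

theorem cliqueInt_ne_top [IsFiniteMeasure μ] (hh : IsCauchySchwarzKernel μ h) (n : ℕ)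
    {a : Ω → ℝ≥0∞} (ha : IsBddWeight a) : cliqueInt μ h n a ≠ ∞ :=
  hh.mixedCliqueInt_ne_top 0 n ha ha

/-- Peeling off a common vertex reduces to smaller `k` or `l` with reweighted `a` and `b`; the
pointwise inequality then integrates by Cauchy–Schwarz. When only two vertices remain, the claim is
the Cauchy–Schwarz property of the kernel. -/
theorem mixedCliqueInt_sq_le [SFinite μ] (hh : IsCauchySchwarzKernel μ h) (k l : ℕ)
    {a b : Ω → ℝ≥0∞} (ha : IsBddWeight a) (hb : IsBddWeight b) :
    mixedCliqueInt μ h (k + 1) (l + 1) a b ^ 2 ≤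
      mixedCliqueInt μ h k (l + 2) a b * mixedCliqueInt μ h (k + 2) l a b := by
  have hm := hh.measurable
  induction k generalizing l a b with
  | zero =>
    induction l generalizing a b with
    | zero =>
      have := hh.cauchySchwarz a b ha hb
      rw [mul_comm] at this
      simpa [mixedCliqueInt, cliqueInt] using this
    | succ l ih =>
      rw [mixedCliqueInt_succ_right hm hh.symm _ _ ha.1 hb.1,
        mixedCliqueInt_succ_right hm hh.symm _ _ ha.1 hb.1,
        mixedCliqueInt_succ_right hm hh.symm _ _ ha.1 hb.1]
      exact lintegral_mul_sq_le_of_sq_le μ hb.1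
        (measurable_mixedCliqueInt hm _ _ (measurable_mul_kernel hm ha.1)
          (measurable_mul_kernel hm hb.1))
        (measurable_mixedCliqueInt hm _ _ (measurable_mul_kernel hm ha.1)
          (measurable_mul_kernel hm hb.1))
        fun x => ih (ha.mul (hh.isBddWeight_left x)) (hb.mul (hh.isBddWeight_left x))
  | succ k ih =>
    exact lintegral_mul_sq_le_of_sq_le μ ha.1
      (measurable_mixedCliqueInt hm _ _ (measurable_mul_kernel hm ha.1)
        (measurable_mul_kernel hm hb.1))
      (measurable_mixedCliqueInt hm _ _ (measurable_mul_kernel hm ha.1)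
        (measurable_mul_kernel hm hb.1))
      fun x => ih l (ha.mul (hh.isBddWeight_left x)) (hb.mul (hh.isBddWeight_left x))

/-- The left integral is the entry `k = 1` of the log-convex sequence of integrals over `K_{d+1}`
with `k` weights `a`; the right side involves its endpoints `k = 0` and `k = d + 1`. -/
theorem lintegral_mul_cliqueInt_pow_le [IsFiniteMeasure μ] (hh : IsCauchySchwarzKernel μ h) (d : ℕ)
    {a b : Ω → ℝ≥0∞} (ha : IsBddWeight a) (hb : IsBddWeight b) :
    (∫⁻ x, a x * cliqueInt μ h d (fun y => b y * h x y) ∂μ) ^ (d + 1) ≤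
      cliqueInt μ h (d + 1) b ^ d * cliqueInt μ h (d + 1) a := by
  have := pow_le_of_logConvex (g := fun k => mixedCliqueInt μ h k (d + 1 - k) a b) (n := d)
    (fun k => hh.mixedCliqueInt_ne_top _ _ ha hb) (fun k hk => by
      have := hh.mixedCliqueInt_sq_le k (d - 1 - k) ha hb
      rw [show d - 1 - k + 1 = d + 1 - (k + 1) by omega, show d - 1 - k + 2 = d + 1 - k by omega,
        show d - 1 - k = d + 1 - (k + 2) by omega] at this
      exact this) d le_rfl
  simp only [Nat.sub_self, Nat.sub_zero, mixedCliqueInt_zero_right] at this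
  simpa [mixedCliqueInt] using this

end IsCauchySchwarzKernel

end Clique

/-- Absorbs an unknown that occurs on both sides of an estimate. The finiteness of `y` is what makes
truncation necessary later. -/
theorem ENNReal.le_of_pow_add_le {y t : ℝ≥0∞} (hy : y ≠ ∞) {m n : ℕ} (hn : n ≠ 0)
    (h : y ^ (m + n) ≤ y ^ m * t ^ n) : y ≤ t := by
  rcases eq_or_ne y 0 with h0 | h0
  · simp [h0]
  rw [pow_add, ENNReal.mul_le_mul_iff_right (pow_ne_zero _ h0) (ENNReal.pow_ne_top hy)] at h
  exact (ENNReal.pow_le_pow_left_iff hn).1 h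

/-! ### The star inequality with equal factors -/

section CliqueRoot

variable {Ω : Type v} [MeasurableSpace Ω]

/-- The clique integral normalized to be homogeneous of degree one in the weight. -/
noncomputable def cliqueRoot (μ : Measure Ω) (h : Ω → Ω → ℝ≥0∞) (n : ℕ) (a : Ω → ℝ≥0∞) : ℝ≥0∞ :=
  cliqueInt μ h n a ^ (1 / (n : ℝ))

theorem cliqueRoot_pow (μ : Measure Ω) (h : Ω → Ω → ℝ≥0∞) {n : ℕ} (hn : n ≠ 0) (a : Ω → ℝ≥0∞) :
    cliqueRoot μ h n a ^ n = cliqueInt μ h n a := by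
  rw [cliqueRoot, ← ENNReal.rpow_mul_natCast, one_div_mul_cancel (by exact_mod_cast hn),
    ENNReal.rpow_one]

theorem cliqueRoot_succ_pow (μ : Measure Ω) (h : Ω → Ω → ℝ≥0∞) (n : ℕ) (a : Ω → ℝ≥0∞) :
    cliqueRoot μ h (n + 1) a ^ (n + 1) = cliqueInt μ h (n + 1) a :=
  cliqueRoot_pow μ h n.succ_ne_zero a

theorem cliqueRoot_one (μ : Measure Ω) (h : Ω → Ω → ℝ≥0∞) (a : Ω → ℝ≥0∞) :
    cliqueRoot μ h 1 a = ∫⁻ x, a x ∂μ := by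
  simp [cliqueRoot, cliqueInt]

theorem cliqueRoot_pow_eq_lintegral (μ : Measure Ω) (h : Ω → Ω → ℝ≥0∞) (n : ℕ)
    (a : Ω → ℝ≥0∞) : cliqueRoot μ h (n + 2) a ^ (n + 2) =
      ∫⁻ x, a x * cliqueRoot μ h (n + 1) (fun y => a y * h x y) ^ (n + 1) ∂μ := by
  simp only [cliqueRoot_succ_pow]
  rfl

namespace IsCauchySchwarzKernel

variable {μ : Measure Ω} [IsFiniteMeasure μ] {h : Ω → Ω → ℝ≥0∞}

theorem cliqueRoot_ne_top (hh : IsCauchySchwarzKernel μ h) (n : ℕ) {a : Ω → ℝ≥0∞}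
    (ha : IsBddWeight a) : cliqueRoot μ h n a ≠ ∞ :=
  ENNReal.rpow_ne_top_of_nonneg (by positivity) (hh.cliqueInt_ne_top n ha)

theorem isBddWeight_cliqueRoot (hh : IsCauchySchwarzKernel μ h) (n : ℕ) {a : Ω → ℝ≥0∞}
    (ha : IsBddWeight a) : IsBddWeight fun x => cliqueRoot μ h n fun y => a y * h x y := by
  obtain ⟨ham, A, hA⟩ := ha
  obtain ⟨C, hC⟩ := hh.bdd
  obtain ⟨D, hD⟩ := hh.exists_cliqueInt_le n (A * C)
  refine ⟨(measurable_cliqueInt hh.measurable n (measurable_mul_kernel hh.measurable ham)).pow_const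
    _, D ^ (1 / (n : ℝ)), fun x => ?_⟩
  rw [ENNReal.coe_rpow_of_nonneg _ (by positivity)]
  refine ENNReal.rpow_le_rpow (hD _ fun y => ?_) (by positivity)
  push_cast
  exact mul_le_mul' (hA y) (hC x y)

/-- The diagonal case `m = d` of the star inequality, where the power undoes the root and
log-convexity applies directly. -/
theorem lintegral_mul_cliqueRoot_pow_self_le (hh : IsCauchySchwarzKernel μ h) (d : ℕ)
    {a b : Ω → ℝ≥0∞} (ha : IsBddWeight a) (hb : IsBddWeight b) :
    ∫⁻ x, a x * cliqueRoot μ h (d + 1) (fun y => b y * h x y) ^ (d + 1) ∂μ ≤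
      cliqueRoot μ h (d + 2) a * cliqueRoot μ h (d + 2) b ^ (d + 1) := by
  refine (ENNReal.pow_le_pow_left_iff (n := d + 2) (by omega)).1 ?_
  simp only [cliqueRoot_succ_pow]
  refine (hh.lintegral_mul_cliqueInt_pow_le (d + 1) ha hb).trans (le_of_eq ?_)
  rw [← cliqueRoot_succ_pow, ← cliqueRoot_succ_pow]
  ring

/-- Inductive step for multiplying a weight by `f`. Opening one vertex of the clique with weight `b
* f` and applying Hölder separates `f` from the smaller clique root `q`. The `f`-part is bounded by
`hT` with weight `b * f`, which brings back the unknown `y`; the `q`-part is bounded by `hS` with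
weight `b * h x`. One factor `y` then cancels. -/
theorem cliqueRoot_mul_le_step (hh : IsCauchySchwarzKernel μ h) {f : Ω → ℝ≥0∞}
    (hf : IsBddWeight f) (c : ℝ≥0∞) (j : ℕ)
    (hT : ∀ a, IsBddWeight a → ∫⁻ x, a x * f x ^ (j + 1) ∂μ ≤ cliqueRoot μ h (j + 2) a * c ^ (j + 1))
    (hS : ∀ b, IsBddWeight b →
      cliqueRoot μ h (j + 1) (fun x => b x * f x) ≤ cliqueRoot μ h (j + 2) b * c)
    {b : Ω → ℝ≥0∞} (hb : IsBddWeight b) :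
    cliqueRoot μ h (j + 2) (fun x => b x * f x) ≤ cliqueRoot μ h (j + 3) b * c := by
  have hbf := hb.mul hf
  set y := cliqueRoot μ h (j + 2) fun x => b x * f x with hy
  set t := cliqueRoot μ h (j + 3) b with ht
  set q : Ω → ℝ≥0∞ := fun x => cliqueRoot μ h (j + 1) fun z => b z * f z * h x z with hq
  have e1 : y ^ (j + 2) = ∫⁻ x, b x * f x * q x ^ (j + 1) ∂μ :=
    cliqueRoot_pow_eq_lintegral μ h j _
  have e2 : ∫⁻ x, b x * f x ^ (j + 2) ∂μ ≤ y * c ^ (j + 1) := by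
    refine le_trans (le_of_eq (lintegral_congr fun x => ?_)) (hT _ hbf)
    ring
  have e3 : ∫⁻ x, b x * q x ^ (j + 2) ∂μ ≤ t ^ (j + 3) * c ^ (j + 2) := by
    rw [ht, cliqueRoot_pow_eq_lintegral, ← lintegral_mul_const]
    · refine lintegral_mono fun x => ?_
      rw [mul_assoc, ← mul_pow]
      gcongr
      refine le_trans (le_of_eq ?_) (hS _ (hb.mul (hh.isBddWeight_left x)))
      simp only [hq]
      congr 1; ext z; ring
    · exact hb.1.mul ((hh.isBddWeight_cliqueRoot _ hb).1.pow_const _)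
  refine ENNReal.le_of_pow_add_le (hh.cliqueRoot_ne_top _ hbf) (m := 1) (n := (j + 1) * (j + 3))
    (by positivity) ?_
  -- The exponents match because `(j + 2)² = 1 + (j + 1)(j + 3)`.
  calc y ^ (1 + (j + 1) * (j + 3)) = (y ^ (j + 2)) ^ (j + 1 + 1) := by ring
    _ ≤ (y * c ^ (j + 1)) * (t ^ (j + 3) * c ^ (j + 2)) ^ (j + 1) := by
      rw [e1]
      exact (lintegral_mul_pow_le μ hb.1 hf.1 (hh.isBddWeight_cliqueRoot _ hbf).1 (j + 1)).trans
        (mul_le_mul' e2 (pow_le_pow_left' e3 _))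
    _ = _ := by ring

/-- Same Hölder split as in `cliqueRoot_mul_le_step`, but with no smaller instance of the conclusion
at hand. The `q`-part is instead bounded by the star inequality `hstar` for smaller cliques, which
returns `y ^ (j + 2)` to be cancelled. -/
theorem cliqueRoot_mul_le_base (hh : IsCauchySchwarzKernel μ h) {f : Ω → ℝ≥0∞}
    (hf : IsBddWeight f) (c : ℝ≥0∞) (j : ℕ)
    (hT : ∀ a, IsBddWeight a → ∫⁻ x, a x * f x ^ (j + 2) ∂μ ≤ cliqueRoot μ h (j + 3) a * c ^ (j + 2))
    (hstar : ∀ a b, IsBddWeight a → IsBddWeight b →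
      ∫⁻ x, a x * cliqueRoot μ h (j + 1) (fun y => b y * h x y) ^ (j + 2) ∂μ ≤
        cliqueRoot μ h (j + 3) a * cliqueRoot μ h (j + 2) b ^ (j + 2))
    {b : Ω → ℝ≥0∞} (hb : IsBddWeight b) :
    cliqueRoot μ h (j + 2) (fun x => b x * f x) ≤ cliqueRoot μ h (j + 3) b * c := by
  have hbf := hb.mul hf
  refine ENNReal.le_of_pow_add_le (hh.cliqueRoot_ne_top _ hbf) (m := (j + 2) * (j + 1))
    (n := j + 2) (by positivity) ?_
  have e := lintegral_mul_pow_le μ hb.1 hf.1 (hh.isBddWeight_cliqueRoot (j + 1) hbf).1 (j + 1)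
  rw [← cliqueRoot_pow_eq_lintegral μ h j] at e
  have e' := e.trans (mul_le_mul' (hT b hb) (pow_le_pow_left' (hstar b _ hb hbf) (j + 1)))
  refine le_trans (le_of_eq ?_) (e'.trans (le_of_eq ?_)) <;> ring

/-- Raises `m` from `d`, carrying two statements together: the bound on `∫ a * f ^ (m + 1)`, and the
cost `c` of replacing weight `b * f` by `b` while adding a vertex to the clique. One new factor `f`
is absorbed into the weight `a`, and the second statement removes it. -/
theorem lintegral_mul_pow_le_of_base (hh : IsCauchySchwarzKernel μ h) {f : Ω → ℝ≥0∞}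
    (hf : IsBddWeight f) (c : ℝ≥0∞) {d m : ℕ} (hdm : d ≤ m)
    (hT : ∀ a, IsBddWeight a → ∫⁻ x, a x * f x ^ (d + 1) ∂μ ≤ cliqueRoot μ h (d + 2) a * c ^ (d + 1))
    (hS : ∀ b, IsBddWeight b →
      cliqueRoot μ h (d + 1) (fun x => b x * f x) ≤ cliqueRoot μ h (d + 2) b * c)
    {a : Ω → ℝ≥0∞} (ha : IsBddWeight a) :
    ∫⁻ x, a x * f x ^ (m + 1) ∂μ ≤ cliqueRoot μ h (m + 2) a * c ^ (m + 1) := by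
  suffices H : (∀ a, IsBddWeight a →
      ∫⁻ x, a x * f x ^ (m + 1) ∂μ ≤ cliqueRoot μ h (m + 2) a * c ^ (m + 1)) ∧
      ∀ b, IsBddWeight b →
        cliqueRoot μ h (m + 1) (fun x => b x * f x) ≤ cliqueRoot μ h (m + 2) b * c from H.1 a ha
  clear ha a
  induction m, hdm using Nat.le_induction with
  | base => exact ⟨hT, hS⟩
  | succ m _ ih =>
    have hS' := fun b hb => hh.cliqueRoot_mul_le_step hf c m ih.1 ih.2 (b := b) hb
    refine ⟨fun a ha => ?_, hS'⟩
    calc ∫⁻ x, a x * f x ^ (m + 1 + 1) ∂μ = ∫⁻ x, a x * f x * f x ^ (m + 1) ∂μ :=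
          lintegral_congr fun x => by ring
      _ ≤ cliqueRoot μ h (m + 2) (fun x => a x * f x) * c ^ (m + 1) := ih.1 _ (ha.mul hf)
      _ ≤ cliqueRoot μ h (m + 3) a * c * c ^ (m + 1) := by gcongr; exact hS' a ha
      _ = _ := by ring

/-- Comparison of a star of cliques with the cliques on its vertices: the center carries the
weight `a`, and `d + 1 ≤ m + 1`. -/
theorem lintegral_mul_cliqueRoot_pow_le (hh : IsCauchySchwarzKernel μ h) {d m : ℕ} (hdm : d ≤ m)
    {a b : Ω → ℝ≥0∞} (ha : IsBddWeight a) (hb : IsBddWeight b) :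
    ∫⁻ x, a x * cliqueRoot μ h (d + 1) (fun y => b y * h x y) ^ (m + 1) ∂μ ≤
      cliqueRoot μ h (m + 2) a * cliqueRoot μ h (d + 2) b ^ (m + 1) := by
  -- Passing from `d` to `d + 1` uses the previous case only at `m = d + 1`, to start the induction
  -- on `m`.
  induction d generalizing m a b with
  | zero =>
    have hT := fun a (ha : IsBddWeight a) => hh.lintegral_mul_cliqueRoot_pow_self_le 0 ha hb
    refine hh.lintegral_mul_pow_le_of_base (hh.isBddWeight_cliqueRoot (0 + 1) hb) _ hdm hT
      (fun b' hb' => ?_) ha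
    rw [cliqueRoot_one]
    simpa using hT b' hb'
  | succ d ih =>
    have hT := fun a (ha : IsBddWeight a) => hh.lintegral_mul_cliqueRoot_pow_self_le (d + 1) ha hb
    have hf := hh.isBddWeight_cliqueRoot (d + 2) hb
    exact hh.lintegral_mul_pow_le_of_base hf _ hdm hT (fun b' hb' =>
      hh.cliqueRoot_mul_le_base hf _ d hT (fun a b ha hb => ih d.le_succ ha hb) hb') ha

end IsCauchySchwarzKernel

end CliqueRoot

/-! ### From positive semidefinite matrices to integral Cauchy–Schwarz -/

section Sampling

open ProbabilityTheory

variable {Ω : Type v} [MeasurableSpace Ω]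

theorem measurePreserving_eval_pair (μ : Measure Ω) [IsProbabilityMeasure μ] {n : ℕ} {i j : Fin n}
    (hij : i ≠ j) : MeasurePreserving (fun x : Fin n → Ω => (x i, x j))
      (Measure.pi fun _ => μ) (μ.prod μ) := by
  refine ⟨by fun_prop, ?_⟩
  have hind := iIndepFun_pi (μ := fun _ : Fin n => μ) (X := fun _ => (id : Ω → Ω))
    fun _ => aemeasurable_id
  have := (hind.indepFun hij).map_prod_eq_prod_map_map
    (measurable_pi_apply i).aemeasurable (measurable_pi_apply j).aemeasurable
  refine this.trans ?_
  congr 1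
  · exact (measurePreserving_eval (fun _ : Fin n => μ) i).map_eq
  · exact (measurePreserving_eval (fun _ : Fin n => μ) j).map_eq

/-- If all sample averages `∑ i j, G (x i, x j)` are nonnegative, so is the integral of `G`. -/
theorem integral_prod_nonneg_of_sample_nonneg (μ : Measure Ω) [IsProbabilityMeasure μ]
    {G : Ω × Ω → ℝ} (hG : Measurable G) {C : ℝ} (hC : ∀ z, ‖G z‖ ≤ C)
    (hpos : ∀ (n : ℕ) (x : Fin n → Ω), 0 ≤ ∑ i, ∑ j, G (x i, x j)) :
    0 ≤ ∫ z, G z ∂μ.prod μ := by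
  set I := ∫ z, G z ∂μ.prod μ
  set D := ∫ x, G (x, x) ∂μ
  -- Average the hypothesis over `n` independent samples: `n` diagonal terms contribute `D` each,
  -- and `n * (n - 1)` off-diagonal terms contribute `I` each. For large `n` the latter dominate.
  have key : ∀ n : ℕ, 0 ≤ (n : ℝ) * (D + (n - 1) * I) := by
    intro n
    have hint : ∀ i j : Fin n, Integrable (fun x : Fin n → Ω => G (x i, x j))
        (Measure.pi fun _ => μ) := fun i j =>
      Integrable.of_bound (hG.comp (by fun_prop)).aestronglyMeasurable C
        (Filter.Eventually.of_forall fun x => hC _)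
    have h0 : 0 ≤ ∫ x : Fin n → Ω, ∑ i, ∑ j, G (x i, x j) ∂Measure.pi fun _ => μ :=
      integral_nonneg fun x => hpos n x
    rw [integral_finsetSum _ fun i _ => integrable_finsetSum _ fun j _ => hint i j] at h0
    simp_rw [integral_finsetSum _ fun j _ => hint _ j] at h0
    have hval : ∀ i j : Fin n, ∫ x : Fin n → Ω, G (x i, x j) ∂Measure.pi (fun _ => μ) =
        I + if i = j then D - I else 0 := by
      intro i j
      split_ifs with hij
      · subst hij
        have := (measurePreserving_eval (fun _ : Fin n => μ) i)
        rw [add_sub_cancel, ← integral_map (φ := fun x : Fin n → Ω => x i)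
          (f := fun y => G (y, y)) (measurable_pi_apply i).aemeasurable
          (hG.comp (by fun_prop)).aestronglyMeasurable]
        rw [show (fun x : Fin n → Ω => x i) = Function.eval i from rfl, this.map_eq]
      · have := measurePreserving_eval_pair μ hij
        rw [add_zero, ← integral_map (φ := fun x : Fin n → Ω => (x i, x j)) (f := G)
          (by fun_prop) hG.aestronglyMeasurable, this.map_eq]
    simp_rw [hval, Finset.sum_add_distrib, Finset.sum_ite_eq] at h0
    simp only [Finset.sum_const, Finset.card_univ, Fintype.card_fin, nsmul_eq_mul,
      Finset.mem_univ, if_true] at h0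
    linarith
  by_contra hI
  rw [not_le] at hI
  obtain ⟨n, hn⟩ := exists_nat_gt (D / (-I))
  rw [div_lt_iff₀ (by linarith)] at hn
  have := key (n + 1)
  push_cast at this
  have := nonneg_of_mul_nonneg_right this (by positivity)
  linarith

theorem integral_prod_nonneg_of_sample_nonneg' (μ : Measure Ω) [IsFiniteMeasure μ]
    {G : Ω × Ω → ℝ} (hG : Measurable G) {C : ℝ} (hC : ∀ z, ‖G z‖ ≤ C)
    (hpos : ∀ (n : ℕ) (x : Fin n → Ω), 0 ≤ ∑ i, ∑ j, G (x i, x j)) :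
    0 ≤ ∫ z, G z ∂μ.prod μ := by
  rcases eq_or_ne μ 0 with rfl | h0
  · simp
  have : NeZero μ := ⟨h0⟩
  have hc : μ Set.univ ≠ ∞ := measure_ne_top _ _
  have hc0 : μ Set.univ ≠ 0 := by simpa using h0
  set ν := (μ Set.univ)⁻¹ • μ with hν
  have hμ : μ = μ Set.univ • ν := by
    rw [hν, smul_smul, ENNReal.mul_inv_cancel hc0 hc, one_smul]
  have := integral_prod_nonneg_of_sample_nonneg ν hG hC hpos
  rw [hμ, Measure.prod_smul_left, Measure.prod_smul_right, integral_smul_measure,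
    integral_smul_measure]
  positivity

/-- A bounded measurable kernel with positive semidefinite finite sections satisfies the
Cauchy–Schwarz inequality against nonnegative functions. -/
theorem isCauchySchwarzKernel_of_posSemidef (μ : Measure Ω) [IsFiniteMeasure μ] {h : Ω → Ω → ℝ≥0}
    (hm : Measurable (Function.uncurry h)) (hs : ∀ x y, h x y = h y x) {C : ℝ≥0}
    (hC : ∀ x y, h x y ≤ C)
    (hpos : ∀ (n : ℕ) (x : Fin n → Ω) (v : Fin n → ℝ), 0 ≤ ∑ i, ∑ j, v i * v j * h (x i) (x j)) :
    IsCauchySchwarzKernel μ fun x y => (h x y : ℝ≥0∞) := by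
  refine ⟨hm.coe_nnreal_ennreal, fun x y => by rw [hs], ⟨C, fun x y => by exact_mod_cast hC x y⟩,
    ?_⟩
  rintro a b ⟨ham, A, hA⟩ ⟨hbm, B, hB⟩
  lift a to Ω → ℝ≥0 using fun x => ne_top_of_le_ne_top ENNReal.coe_ne_top (hA x)
  lift b to Ω → ℝ≥0 using fun x => ne_top_of_le_ne_top ENNReal.coe_ne_top (hB x)
  replace ham : Measurable a := measurable_coe_nnreal_ennreal_iff.1 ham
  replace hbm : Measurable b := measurable_coe_nnreal_ennreal_iff.1 hbm
  have hA' : ∀ x, a x ≤ A := fun x => ENNReal.coe_le_coe.1 (hA x)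
  have hB' : ∀ x, b x ≤ B := fun x => ENNReal.coe_le_coe.1 (hB x)
  have hmr : Measurable fun z : Ω × Ω => (h z.1 z.2 : ℝ) := hm.coe_nnreal_real
  let J : (Ω → ℝ≥0) → (Ω → ℝ≥0) → ℝ := fun u w =>
    ∫ z : Ω × Ω, (u z.1 : ℝ) * w z.2 * h z.1 z.2 ∂μ.prod μ
  have hint : ∀ {u w : Ω → ℝ≥0} {U W : ℝ≥0}, Measurable u → Measurable w → (∀ x, u x ≤ U) →
      (∀ x, w x ≤ W) → Integrable (fun z : Ω × Ω => (u z.1 : ℝ) * w z.2 * h z.1 z.2)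
        (μ.prod μ) := by
    intro u w U W hu hw hU hW
    refine Integrable.of_bound (C := ((U * W * C : ℝ≥0) : ℝ)) ?_ ?_
    · exact (((hu.comp measurable_fst).coe_nnreal_real.mul
        (hw.comp measurable_snd).coe_nnreal_real).mul hmr).aestronglyMeasurable
    · refine Filter.Eventually.of_forall fun z => ?_
      rw [Real.norm_of_nonneg (by positivity)]
      have := mul_le_mul' (mul_le_mul' (hU z.1) (hW z.2)) (hC z.1 z.2)
      exact_mod_cast this
  have conv : ∀ {u w : Ω → ℝ≥0} {U W : ℝ≥0}, Measurable u → Measurable w → (∀ x, u x ≤ U) →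
      (∀ x, w x ≤ W) →
      ∫⁻ x, (u x : ℝ≥0∞) * ∫⁻ y, (w y : ℝ≥0∞) * h x y ∂μ ∂μ = ENNReal.ofReal (J u w) := by
    intro u w U W hu hw hU hW
    rw [ofReal_integral_eq_lintegral_ofReal (hint hu hw hU hW)
      (Filter.Eventually.of_forall fun z => by positivity), lintegral_prod]
    · refine lintegral_congr fun x => ?_
      rw [← lintegral_const_mul]
      · refine lintegral_congr fun y => ?_
        rw [ENNReal.ofReal_mul (by positivity), ENNReal.ofReal_mul (by positivity)]
        simp [mul_assoc]
      · exact hw.coe_nnreal_ennreal.mul (hm.comp measurable_prodMk_left).coe_nnreal_ennreal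
    · exact (((hu.comp measurable_fst).coe_nnreal_real.mul
        (hw.comp measurable_snd).coe_nnreal_real).mul hmr).ennreal_ofReal.aemeasurable
  have hsymm : J b a = J a b := by
    simp only [J]
    rw [← integral_prod_swap]
    refine integral_congr_ae (Filter.Eventually.of_forall fun z => ?_)
    simp only [Prod.fst_swap, Prod.snd_swap, hs z.2 z.1]
    ring
  -- This is the form evaluated at the signed function `s * a + b`; its discriminant in `s` gives
  -- Cauchy–Schwarz.
  have hquad : ∀ s : ℝ, 0 ≤ J a a * (s * s) + 2 * J a b * s + J b b := by
    intro s
    have e : J a a * (s * s) + 2 * J a b * s + J b b =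
        ∫ z : Ω × Ω, (s * a z.1 + b z.1) * (s * a z.2 + b z.2) * h z.1 z.2 ∂μ.prod μ := by
      have : 2 * J a b * s = s * J a b + s * J b a := by rw [hsymm]; ring
      rw [this]
      have e1 : ∀ z : Ω × Ω, (s * (a z.1 : ℝ) + b z.1) * (s * a z.2 + b z.2) * h z.1 z.2 =
        (s * s) * ((a z.1 : ℝ) * a z.2 * h z.1 z.2) + (s * ((a z.1 : ℝ) * b z.2 * h z.1 z.2) +
          s * ((b z.1 : ℝ) * a z.2 * h z.1 z.2)) + (b z.1 : ℝ) * b z.2 * h z.1 z.2 :=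
        fun z => by ring
      simp_rw [e1]
      have i1 := (hint ham ham hA' hA').const_mul (s * s)
      have i2 := (hint ham hbm hA' hB').const_mul s
      have i3 := (hint hbm ham hB' hA').const_mul s
      have i4 := hint hbm hbm hB' hB'
      have k1 := integral_add (i1.add (i2.add i3)) i4
      have k2 := integral_add i1 (i2.add i3)
      have k3 := integral_add i2 i3
      simp only [Pi.add_apply] at k1 k2
      rw [k1, k2, k3]
      simp only [integral_const_mul, J]
      ring
    rw [e]
    refine integral_prod_nonneg_of_sample_nonneg' μ (C := (|s| * A + B) * (|s| * A + B) * C)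
      ?_ ?_ fun n x => hpos n x fun i => s * a (x i) + b (x i)
    · have h1 : Measurable fun x => s * (a x : ℝ) + b x :=
        (ham.coe_nnreal_real.const_mul s).add hbm.coe_nnreal_real
      exact ((h1.comp measurable_fst).mul (h1.comp measurable_snd)).mul hmr
    · have hb1 : ∀ x, ‖s * (a x : ℝ) + b x‖ ≤ |s| * A + B := fun x => by
        refine (norm_add_le _ _).trans ?_
        rw [norm_mul, Real.norm_eq_abs, NNReal.norm_eq, NNReal.norm_eq]
        gcongr
        · exact_mod_cast hA' x
        · exact_mod_cast hB' x
      intro z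
      rw [norm_mul, norm_mul, NNReal.norm_eq]
      have := hb1 z.1
      have := hb1 z.2
      have : (h z.1 z.2 : ℝ) ≤ C := by exact_mod_cast hC z.1 z.2
      gcongr
  have hJ : ∀ u w, 0 ≤ J u w := fun u w => integral_nonneg fun z => by positivity
  rw [conv ham hbm hA' hB', conv ham ham hA' hA', conv hbm hbm hB' hB',
    ← ENNReal.ofReal_pow (hJ _ _), ← ENNReal.ofReal_mul (hJ _ _)]
  apply ENNReal.ofReal_le_ofReal
  have := discrim_le_zero hquad
  rw [discrim] at this
  linarith

end Sampling

/-! ### The star inequality with different factors -/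

section Star

variable {Ω : Type v} [MeasurableSpace Ω]

theorem lintegral_mul_prod_le {ι : Type u} (μ : Measure Ω) {w : Ω → ℝ≥0∞} (hw : Measurable w)
    {s : Finset ι} (hs : s.Nonempty) {f : ι → Ω → ℝ≥0∞} (hf : ∀ i ∈ s, Measurable (f i)) :
    ∫⁻ x, w x * ∏ i ∈ s, f i x ∂μ ≤
      ∏ i ∈ s, (∫⁻ x, w x * f i x ^ s.card ∂μ) ^ (1 / (s.card : ℝ)) := by
  have hc : (s.card : ℝ) ≠ 0 := by exact_mod_cast hs.card_pos.ne'
  refine le_trans (le_of_eq (lintegral_congr fun x => ?_))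
    (ENNReal.lintegral_prod_norm_pow_le s (p := fun _ => 1 / (s.card : ℝ))
      (fun i hi => (hw.mul ((hf i hi).pow_const _)).aemeasurable) ?_ fun _ _ => by positivity)
  · simp only [Pi.mul_apply]
    have e : ∀ i ∈ s, (w x * f i x ^ s.card) ^ (1 / (s.card : ℝ)) =
        w x ^ (1 / (s.card : ℝ)) * f i x := fun i _ => by
      rw [ENNReal.mul_rpow_of_nonneg _ _ (by positivity), ← ENNReal.rpow_natCast_mul,
        mul_one_div_cancel hc, ENNReal.rpow_one]
    rw [Finset.prod_congr rfl e, Finset.prod_mul_distrib, Finset.prod_const,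
      ← ENNReal.rpow_mul_natCast, one_div_mul_cancel hc, ENNReal.rpow_one]
  · rw [Finset.sum_const, nsmul_eq_mul, mul_one_div_cancel hc]

/-- Hölder with equal exponents `1 / s.card` leaves one equal-factor star per leaf, where `d i <
s.card` is the required range. The `s.card` fractional powers of the root at the center multiply
back to one. -/
theorem IsCauchySchwarzKernel.lintegral_mul_prod_cliqueRoot_le {ι : Type u} {μ : Measure Ω}
    [IsFiniteMeasure μ] {h : Ω → Ω → ℝ≥0∞} (hh : IsCauchySchwarzKernel μ h) (s : Finset ι)
    (d : ι → ℕ) (hd : ∀ i ∈ s, d i < s.card) {a : Ω → ℝ≥0∞} {b : ι → Ω → ℝ≥0∞}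
    (ha : IsBddWeight a) (hb : ∀ i, IsBddWeight (b i)) :
    ∫⁻ x, a x * ∏ i ∈ s, cliqueRoot μ h (d i + 1) (fun y => b i y * h x y) ∂μ ≤
      cliqueRoot μ h (s.card + 1) a * ∏ i ∈ s, cliqueRoot μ h (d i + 2) (b i) := by
  rcases s.eq_empty_or_nonempty with rfl | hs
  · simp [cliqueRoot_one]
  obtain ⟨m, hm⟩ := Nat.exists_eq_succ_of_ne_zero hs.card_pos.ne'
  have hc : (s.card : ℝ) ≠ 0 := by exact_mod_cast hs.card_pos.ne'
  refine (lintegral_mul_prod_le μ ha.1 hs fun i _ => (hh.isBddWeight_cliqueRoot _ (hb i)).1).trans ?_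
  calc _ ≤ ∏ i ∈ s, cliqueRoot μ h (s.card + 1) a ^ (1 / (s.card : ℝ)) *
        cliqueRoot μ h (d i + 2) (b i) := by
        refine Finset.prod_le_prod' fun i hi => ?_
        have := hh.lintegral_mul_cliqueRoot_pow_le (d := d i) (m := m)
          (by have := hd i hi; omega) ha (hb i)
        rw [← Nat.succ_eq_add_one m, ← hm, show m + 2 = s.card + 1 by omega] at this
        refine (ENNReal.rpow_le_rpow this (by positivity : 0 ≤ 1 / (s.card : ℝ))).trans
          (le_of_eq ?_)
        rw [ENNReal.mul_rpow_of_nonneg _ _ (by positivity),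
          ← ENNReal.rpow_natCast_mul, mul_one_div_cancel hc, ENNReal.rpow_one]
    _ = _ := by
        rw [Finset.prod_mul_distrib, Finset.prod_const, ← ENNReal.rpow_mul_natCast,
          one_div_mul_cancel hc, ENNReal.rpow_one]

end Star

/-! ### Induction on the vertices of the graph -/

namespace WeightedGraph

variable {Ω : Type v} [MeasurableSpace Ω] {V : Type u}

@[simp] theorem edgeWeight_mk (H : WeightedGraph Ω) (x : V → Ω) (a b : V) :
    H.edgeWeight x s(a, b) = H.weight (x a) (x b) := rfl

/-- The extended-real-valued kernel of a weighted graph. -/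
noncomputable def kernel (H : WeightedGraph Ω) (x y : Ω) : ℝ≥0∞ := H.weight x y

theorem measurable_kernel (H : WeightedGraph Ω) : Measurable (Function.uncurry H.kernel) :=
  H.measurable.coe_nnreal_ennreal

/-- The number of neighbours of `a` in `s`. -/
def degreeIn (G : SimpleGraph V) [DecidableRel G.Adj] (s : Finset V) (a : V) : ℕ :=
  #{b ∈ s | G.Adj a b}

/-- The weights on the remaining vertices after the vertex `w` receives the color `c`. -/
noncomputable def condWeight (G : SimpleGraph V) [DecidableRel G.Adj] (H : WeightedGraph Ω)
    (lam : V → Ω → ℝ≥0∞) (w : V) (c : Ω) (a : V) (y : Ω) : ℝ≥0∞ :=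
  if G.Adj w a then lam a y * H.kernel c y else lam a y

variable (G : SimpleGraph V) [DecidableRel G.Adj] (H : WeightedGraph Ω)

theorem measurable_edgeWeight (e : Sym2 V) : Measurable fun x : V → Ω => H.edgeWeight x e := by
  induction e with
  | _ a b => exact H.measurable.comp (by fun_prop : Measurable fun x : V → Ω => (x a, x b))

theorem measurable_condWeight {lam : V → Ω → ℝ≥0∞} (hlam : ∀ a, Measurable (lam a)) (w : V)
    (c : Ω) (a : V) : Measurable (condWeight G H lam w c a) := by
  unfold condWeight
  split_ifs
  · exact (hlam a).mul (H.measurable_kernel.comp measurable_prodMk_left)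
  · exact hlam a

variable [DecidableEq V]

theorem degreeIn_insert {w : V} {t : Finset V} (hw : w ∉ t) (a : V) :
    degreeIn G (insert w t) a = degreeIn G t a + if G.Adj w a then 1 else 0 := by
  simp only [degreeIn, Finset.filter_insert, G.adj_comm a w]
  split_ifs
  · rw [Finset.card_insert_of_notMem (by simp [hw])]
  · rfl

theorem degreeIn_insert_self {w : V} {t : Finset V} :
    degreeIn G (insert w t) w = #{b ∈ t | G.Adj w b} := by
  rw [degreeIn, Finset.filter_insert, if_neg (G.irrefl)]

variable [Fintype V]

/-- The integrand of the weighted homomorphism count of the subgraph of `G` induced on `s`. -/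
noncomputable def inducedIntegrand (s : Finset V) (lam : V → Ω → ℝ≥0∞) (x : V → Ω) : ℝ≥0∞ :=
  (∏ e ∈ G.edgeFinset with e ∈ s.sym2, (H.edgeWeight x e : ℝ≥0∞)) * ∏ a ∈ s, lam a (x a)

theorem measurable_inducedIntegrand (s : Finset V) {lam : V → Ω → ℝ≥0∞}
    (hlam : ∀ a, Measurable (lam a)) : Measurable (inducedIntegrand G H s lam) := by
  refine Measurable.mul (Finset.measurable_fun_prod _ fun e _ =>
    (H.measurable_edgeWeight e).coe_nnreal_ennreal)
    (Finset.measurable_fun_prod _ fun a _ => (hlam a).comp (measurable_pi_apply a))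

/-- The edges inside `insert w t` are those inside `t` and those joining `w` to `t`; the latter are
absorbed into the weights of the neighbours of `w`. -/
theorem inducedIntegrand_insert {w : V} {t : Finset V} (hw : w ∉ t) (lam : V → Ω → ℝ≥0∞)
    (x : V → Ω) : inducedIntegrand G H (insert w t) lam x =
      lam w (x w) * inducedIntegrand G H t (condWeight G H lam w (x w)) x := by
  have e : G.edgeFinset.filter (· ∈ (insert w t).sym2) = G.edgeFinset.filter (· ∈ t.sym2) ∪
      (t.filter (G.Adj w)).image fun a => s(w, a) := by
    ext e
    induction e with
    | _ a b =>
      simp only [Finset.mem_filter, SimpleGraph.mem_edgeFinset, SimpleGraph.mem_edgeSet,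
        Finset.mk_mem_sym2_iff, Finset.mem_insert, Finset.mem_union, Finset.mem_image,
        Sym2.eq_iff]
      constructor
      · rintro ⟨hab, rfl | ha, rfl | hb⟩
        · exact absurd hab (G.irrefl)
        · exact Or.inr ⟨b, ⟨hb, hab⟩, Or.inl ⟨rfl, rfl⟩⟩
        · exact Or.inr ⟨a, ⟨ha, hab.symm⟩, Or.inr ⟨rfl, rfl⟩⟩
        · exact Or.inl ⟨hab, ha, hb⟩
      · rintro (⟨hab, ha, hb⟩ | ⟨c, ⟨hc, hwc⟩, ⟨rfl, rfl⟩ | ⟨rfl, rfl⟩⟩)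
        · exact ⟨hab, Or.inr ha, Or.inr hb⟩
        · exact ⟨hwc, Or.inl rfl, Or.inr hc⟩
        · exact ⟨hwc.symm, Or.inr hc, Or.inl rfl⟩
  have hdisj : Disjoint (G.edgeFinset.filter (· ∈ t.sym2))
      ((t.filter (G.Adj w)).image fun a => s(w, a)) := by
    rw [Finset.disjoint_left]
    intro e he he'
    obtain ⟨a, -, rfl⟩ := Finset.mem_image.1 he'
    exact hw (Finset.mk_mem_sym2_iff.1 (Finset.mem_filter.1 he).2).1
  have hcond : ∏ a ∈ t, condWeight G H lam w (x w) a (x a) =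
      (∏ a ∈ t with G.Adj w a, H.kernel (x w) (x a)) * ∏ a ∈ t, lam a (x a) := by
    rw [Finset.prod_filter, ← Finset.prod_mul_distrib]
    refine Finset.prod_congr rfl fun a _ => ?_
    rw [condWeight]
    split_ifs
    · rw [mul_comm]
    · rw [one_mul]
  rw [inducedIntegrand, inducedIntegrand, e, Finset.prod_union hdisj, Finset.prod_image
    (fun a _ b _ hab => Sym2.congr_right.1 hab), Finset.prod_insert hw, hcond]
  simp only [edgeWeight_mk, kernel]
  ring

theorem inducedIntegrand_congr {s : Finset V} {lam lam' : V → Ω → ℝ≥0∞}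
    (h : ∀ a ∈ s, lam a = lam' a) (x : V → Ω) :
    inducedIntegrand G H s lam x = inducedIntegrand G H s lam' x := by
  rw [inducedIntegrand, inducedIntegrand]
  congr 1
  exact Finset.prod_congr rfl fun a ha => by rw [h a ha]

theorem lmarginal_inducedIntegrand_insert (μ : Measure Ω) [SigmaFinite μ] {w : V} {t : Finset V}
    (hw : w ∉ t) {lam : V → Ω → ℝ≥0∞} (hlam : ∀ a, Measurable (lam a)) (x : V → Ω) :
    lmarginal (fun _ : V => μ) (insert w t) (inducedIntegrand G H (insert w t) lam) x =
      ∫⁻ c, lam w c * lmarginal (fun _ : V => μ) t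
        (inducedIntegrand G H t (condWeight G H lam w c)) (Function.update x w c) ∂μ := by
  rw [lmarginal_insert _ (measurable_inducedIntegrand G H _ hlam) hw]
  refine lintegral_congr fun c => ?_
  rw [lmarginal, lmarginal, ← lintegral_const_mul]
  · refine lintegral_congr fun y => ?_
    have : Function.updateFinset (Function.update x w c) t y w = c := by
      simp [Function.updateFinset, hw]
    rw [inducedIntegrand_insert G H hw, this]
  · exact (measurable_inducedIntegrand G H t (measurable_condWeight G H hlam w c)).comp
      measurable_updateFinset

theorem lmarginal_inducedIntegrand_top (μ : Measure Ω) [SigmaFinite μ] (s : Finset V)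
    {a : Ω → ℝ≥0∞} (ha : Measurable a) (x : V → Ω) :
    lmarginal (fun _ : V => μ) s (inducedIntegrand ⊤ H s fun _ => a) x =
      cliqueInt μ H.kernel s.card a := by
  induction s using Finset.induction_on generalizing a x with
  | empty => simp [inducedIntegrand, cliqueInt]
  | insert w t hw ih =>
    rw [lmarginal_inducedIntegrand_insert _ _ _ hw fun _ => ha, Finset.card_insert_of_notMem hw,
      cliqueInt]
    refine lintegral_congr fun c => ?_
    rw [← ih (a := fun y => a y * H.kernel c y)
      (ha.mul (H.measurable_kernel.comp measurable_prodMk_left)) (Function.update x w c)]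
    congr 2
    ext z
    -- In a complete graph all remaining vertices are reweighted alike. The two weight families
    -- differ only at `w`, which is outside `t`.
    refine inducedIntegrand_congr _ _ (fun b hb => ?_) z
    have : w ≠ b := fun h => hw (h ▸ hb)
    ext y
    simp [condWeight, this]

/-- The main induction. Removing `w` lowers the degree of its neighbours by one and leaves the
others unchanged, so non-neighbours give a constant `K` and neighbours form a star centered at `w`.
-/
theorem lmarginal_inducedIntegrand_le (μ : Measure Ω) [IsFiniteMeasure μ]
    (hh : IsCauchySchwarzKernel μ H.kernel) (s : Finset V) {lam : V → Ω → ℝ≥0∞}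
    (hlam : ∀ a, IsBddWeight (lam a)) (x : V → Ω) :
    lmarginal (fun _ : V => μ) s (inducedIntegrand G H s lam) x ≤
      ∏ a ∈ s, cliqueRoot μ H.kernel (degreeIn G s a + 1) (lam a) := by
  induction hn : s.card generalizing s lam x with
  | zero =>
    rw [Finset.card_eq_zero] at hn
    subst hn
    simp [inducedIntegrand]
  | succ n ih =>
    -- Maximality supplies the condition `d i < s.card` of the star inequality: a neighbour of `w`
    -- has degree at most `N.card`, hence less than that after `w` is removed.
    obtain ⟨w, hws, hmax⟩ := s.exists_max_image (degreeIn G s) (Finset.card_pos.1 (by omega))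
    obtain ⟨t, hw, rfl⟩ : ∃ t, w ∉ t ∧ insert w t = s :=
      ⟨s.erase w, Finset.notMem_erase w s, Finset.insert_erase hws⟩
    rw [Finset.card_insert_of_notMem hw, Nat.add_right_cancel_iff] at hn
    rw [lmarginal_inducedIntegrand_insert _ _ _ hw fun a => (hlam a).1]
    have hcond : ∀ c a, IsBddWeight (condWeight G H lam w c a) := fun c a => by
      unfold condWeight
      split_ifs
      · exact (hlam a).mul (hh.isBddWeight_left c)
      · exact hlam a
    set N := t.filter (G.Adj w)
    set K := ∏ a ∈ t with ¬ G.Adj w a, cliqueRoot μ H.kernel (degreeIn G (insert w t) a + 1) (lam a)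
    have hdeg : ∀ a ∈ N, degreeIn G (insert w t) a = degreeIn G t a + 1 := fun a ha => by
      rw [degreeIn_insert G hw, if_pos (Finset.mem_filter.1 ha).2]
    calc _ ≤ ∫⁻ c, lam w c * ∏ a ∈ t, cliqueRoot μ H.kernel (degreeIn G t a + 1)
          (condWeight G H lam w c a) ∂μ :=
          lintegral_mono fun c => mul_le_mul_right (ih t (hcond c) _ hn) _
      _ = ∫⁻ c, K * (lam w c * ∏ a ∈ N, cliqueRoot μ H.kernel (degreeIn G t a + 1)
          fun y => lam a y * H.kernel c y) ∂μ := by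
          refine lintegral_congr fun c => ?_
          rw [← Finset.prod_filter_mul_prod_filter_not t (G.Adj w)]
          have e1 : ∏ a ∈ t with G.Adj w a, cliqueRoot μ H.kernel (degreeIn G t a + 1)
              (condWeight G H lam w c a) = ∏ a ∈ N, cliqueRoot μ H.kernel (degreeIn G t a + 1)
              fun y => lam a y * H.kernel c y :=
            Finset.prod_congr rfl fun a ha => by
              congr 1; ext y; rw [condWeight, if_pos (Finset.mem_filter.1 ha).2]
          have e2 : ∏ a ∈ t with ¬ G.Adj w a, cliqueRoot μ H.kernel (degreeIn G t a + 1)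
              (condWeight G H lam w c a) = K :=
            Finset.prod_congr rfl fun a ha => by
              rw [degreeIn_insert G hw, if_neg (Finset.mem_filter.1 ha).2, add_zero]
              congr 1; ext y; rw [condWeight, if_neg (Finset.mem_filter.1 ha).2]
          rw [e1, e2]; ring
      _ = K * ∫⁻ c, lam w c * ∏ a ∈ N, cliqueRoot μ H.kernel (degreeIn G t a + 1)
          (fun y => lam a y * H.kernel c y) ∂μ :=
          lintegral_const_mul _ ((hlam w).1.mul (Finset.measurable_fun_prod _ fun a _ =>
            (hh.isBddWeight_cliqueRoot _ (hlam a)).1))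
      _ ≤ K * (cliqueRoot μ H.kernel (N.card + 1) (lam w) *
          ∏ a ∈ N, cliqueRoot μ H.kernel (degreeIn G t a + 2) (lam a)) := by
          gcongr
          refine hh.lintegral_mul_prod_cliqueRoot_le N _ (fun a ha => ?_) (hlam w) hlam
          have := hmax a (Finset.mem_insert_of_mem (Finset.mem_filter.1 ha).1)
          rw [hdeg a ha, degreeIn_insert_self] at this
          change _ ≤ N.card at this
          omega
      _ = _ := by
          rw [Finset.prod_insert hw, degreeIn_insert_self,
            ← Finset.prod_filter_mul_prod_filter_not t (G.Adj w)]
          have e1 : ∏ a ∈ t with G.Adj w a, cliqueRoot μ H.kernel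
              (degreeIn G (insert w t) a + 1) (lam a) =
              ∏ a ∈ N, cliqueRoot μ H.kernel (degreeIn G t a + 2) (lam a) :=
            Finset.prod_congr rfl fun a ha => by rw [hdeg a ha]
          rw [e1]; ring

end WeightedGraph

/-! ### Monotonicity of clique integrals -/

section Mono

variable {Ω : Type v} [MeasurableSpace Ω]

theorem cliqueInt_mono {μ ν : Measure Ω} (hμ : μ ≤ ν) {h k : Ω → Ω → ℝ≥0∞}
    (hk : ∀ x y, h x y ≤ k x y) (n : ℕ) {a b : Ω → ℝ≥0∞} (hab : ∀ x, a x ≤ b x) :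
    cliqueInt μ h n a ≤ cliqueInt ν k n b := by
  induction n generalizing a b with
  | zero => exact le_rfl
  | succ n ih =>
    exact lintegral_mono' hμ fun x =>
      mul_le_mul' (hab x) (ih fun y => mul_le_mul' (hab y) (hk x y))

theorem cliqueRoot_mono {μ ν : Measure Ω} (hμ : μ ≤ ν) {h k : Ω → Ω → ℝ≥0∞}
    (hk : ∀ x y, h x y ≤ k x y) (n : ℕ) {a b : Ω → ℝ≥0∞} (hab : ∀ x, a x ≤ b x) :
    cliqueRoot μ h n a ≤ cliqueRoot ν k n b :=
  ENNReal.rpow_le_rpow (cliqueInt_mono hμ hk n hab) (by positivity)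

end Mono

/-! ### Truncation and passage to the limit -/

namespace WeightedGraph

variable {Ω : Type v} [MeasurableSpace Ω]

theorem IsPosSemidef.sum_nonneg {H : WeightedGraph Ω} (hH : H.IsPosSemidef) {n : ℕ}
    (x : Fin n → Ω) (v : Fin n → ℝ) : 0 ≤ ∑ i, ∑ j, v i * v j * (H.weight (x i) (x j) : ℝ) := by
  refine ((hH n x).dotProduct_mulVec_nonneg v).trans (le_of_eq ?_)
  simp only [dotProduct, Matrix.mulVec, Finset.mul_sum, Matrix.of_apply, Pi.star_apply,
    star_trivial]
  exact Finset.sum_congr rfl fun i _ => Finset.sum_congr rfl fun j _ => by ring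

/-- A nonnegative `2 × 2` determinant bounds the off-diagonal entry, so truncating on the diagonal
alone makes the kernel bounded. -/
theorem IsPosSemidef.weight_le {H : WeightedGraph Ω} (hH : H.IsPosSemidef) {x y : Ω} {C : ℝ≥0}
    (hx : H.weight x x ≤ C) (hy : H.weight y y ≤ C) : H.weight x y ≤ C := by
  have := (hH 2 ![x, y]).det_nonneg
  simp only [Matrix.det_fin_two, Matrix.of_apply, Matrix.cons_val_zero, Matrix.cons_val_one,
    H.symm y x] at this
  have h2 : H.weight x y ^ 2 ≤ H.weight x x * H.weight y y := by
    rw [← NNReal.coe_le_coe]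
    push_cast
    linarith
  refine (pow_le_pow_iff_left₀ zero_le zero_le two_ne_zero).1 (h2.trans ?_)
  rw [sq]
  exact mul_le_mul' hx hy

open Classical in
/-- The weighted graph obtained by deleting all edges with an endpoint outside `B`. -/
noncomputable def restrict (H : WeightedGraph Ω) {B : Set Ω} (hB : MeasurableSet B) :
    WeightedGraph Ω where
  weight x y := if x ∈ B ∧ y ∈ B then H.weight x y else 0
  symm x y := by simp only [H.symm x y, and_comm]
  measurable := by
    refine Measurable.ite ?_ H.measurable measurable_const
    exact (measurable_fst hB).inter (measurable_snd hB)

theorem restrict_kernel_le (H : WeightedGraph Ω) {B : Set Ω} (hB : MeasurableSet B) (x y : Ω) :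
    (H.restrict hB).kernel x y ≤ H.kernel x y := by
  simp only [kernel, restrict, ENNReal.coe_le_coe]
  split_ifs
  exacts [le_rfl, zero_le]

theorem IsPosSemidef.isCauchySchwarzKernel_restrict {H : WeightedGraph Ω} (hH : H.IsPosSemidef)
    (μ : Measure Ω) [IsFiniteMeasure μ] {B : Set Ω} (hB : MeasurableSet B) {C : ℝ≥0}
    (hC : ∀ x ∈ B, H.weight x x ≤ C) : IsCauchySchwarzKernel μ (H.restrict hB).kernel := by
  classical
  refine isCauchySchwarzKernel_of_posSemidef μ (H.restrict hB).measurable (H.restrict hB).symm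
    (C := C) (fun x y => ?_) fun n x v => ?_
  · simp only [restrict]
    split_ifs with hxy
    exacts [hH.weight_le (hC x hxy.1) (hC y hxy.2), zero_le]
  -- Zeroing the kernel outside `B` amounts to zeroing the test vector there.
  · refine (hH.sum_nonneg x fun i => if x i ∈ B then v i else 0).trans (le_of_eq ?_)
    refine Finset.sum_congr rfl fun i _ => Finset.sum_congr rfl fun j _ => ?_
    by_cases hi : x i ∈ B <;> by_cases hj : x j ∈ B <;> simp [restrict, hi, hj]

theorem homWeighted_top (μ : Measure Ω) [SigmaFinite μ] (H : WeightedGraph Ω) (n : ℕ)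
    {a : Ω → ℝ≥0} (ha : Measurable a) :
    homWeighted μ (⊤ : SimpleGraph (Fin (n + 1))) H (fun _ => a) =
      cliqueInt μ H.kernel (n + 1) fun x => a x := by
  rcases isEmpty_or_nonempty Ω with h | ⟨⟨x⟩⟩
  · rw [homWeighted, cliqueInt, lintegral_of_isEmpty, lintegral_of_isEmpty]
  · have := lmarginal_inducedIntegrand_top H μ (Finset.univ : Finset (Fin (n + 1)))
      ha.coe_nnreal_ennreal fun _ => x
    rw [Finset.card_univ, Fintype.card_fin] at this
    rw [← this, ← lintegral_eq_lmarginal_univ]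
    simp [homWeighted, inducedIntegrand]

variable {V : Type u} [Fintype V] (G : SimpleGraph V) [DecidableRel G.Adj] (H : WeightedGraph Ω)

theorem homWeighted_restrict_le (hH : H.IsPosSemidef) (μ : Measure Ω) [IsFiniteMeasure μ]
    {B : Set Ω} (hB : MeasurableSet B) {C : ℝ≥0} (hC : ∀ x ∈ B, H.weight x x ≤ C)
    {lam : V → Ω → ℝ≥0} (hlam : ∀ a, Measurable (lam a)) (hlamC : ∀ a x, lam a x ≤ C) :
    homWeighted μ G (H.restrict hB) lam ≤
      ∏ a, cliqueRoot μ (H.restrict hB).kernel (G.degree a + 1) fun x => lam a x := by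
  classical
  -- `lmarginal` needs a base coloring; if there is none, the integral vanishes.
  rcases isEmpty_or_nonempty (V → Ω) with h | ⟨⟨x⟩⟩
  · rw [homWeighted, lintegral_of_isEmpty]
    exact zero_le
  · have := lmarginal_inducedIntegrand_le G (H.restrict hB) μ
      (hH.isCauchySchwarzKernel_restrict μ hB hC) Finset.univ
      (lam := fun a x => lam a x) (fun a => ⟨(hlam a).coe_nnreal_ennreal, C, fun x => ENNReal.coe_le_coe.2 (hlamC a x)⟩) x
    rw [← lintegral_eq_lmarginal_univ] at this
    have hd : ∀ a, degreeIn G Finset.univ a = G.degree a := fun a => by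
      rw [degreeIn, ← SimpleGraph.card_neighborFinset_eq_degree,
        SimpleGraph.neighborFinset_eq_filter]
    simpa [homWeighted, inducedIntegrand, hd] using this

/-- The region of colors used to truncate `H` and `μ` at level `n`. -/
def truncSet (μ : Measure Ω) [SigmaFinite μ] (n : ℕ) : Set Ω :=
  spanningSets μ n ∩ {x | H.weight x x ≤ n}

theorem measurableSet_truncSet (μ : Measure Ω) [SigmaFinite μ] (n : ℕ) :
    MeasurableSet (H.truncSet μ n) :=
  (measurableSet_spanningSets μ n).inter (measurableSet_le
    (H.measurable.comp (by fun_prop : Measurable fun x : Ω => (x, x))) measurable_const)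

theorem monotone_truncSet (μ : Measure Ω) [SigmaFinite μ] : Monotone (H.truncSet μ) :=
  fun m n hmn => Set.inter_subset_inter (monotone_spanningSets μ hmn) fun x hx =>
    le_trans (b := (m : ℝ≥0)) hx (by exact_mod_cast hmn)

theorem eventually_mem_truncSet (μ : Measure Ω) [SigmaFinite μ] (x : Ω) :
    ∀ᶠ n in Filter.atTop, x ∈ H.truncSet μ n := by
  obtain ⟨m, hm⟩ := exists_nat_ge (H.weight x x)
  filter_upwards [Filter.eventually_ge_atTop (max m (spanningSetsIndex μ x))] with n hn
  exact ⟨monotone_spanningSets μ (le_of_max_le_right hn) (mem_spanningSetsIndex μ x),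
    hm.trans (by exact_mod_cast le_of_max_le_left hn)⟩

/-- Restricting the measure already confines the colors to the truncation set, where the truncated
kernel agrees with `H`. Moving everything into the integrand gives a fixed measure, as monotone
convergence needs. -/
theorem homWeighted_truncation (μ : Measure Ω) [SigmaFinite μ] (n : ℕ) (lam : V → Ω → ℝ≥0) :
    homWeighted (μ.restrict (H.truncSet μ n)) G (H.restrict (H.measurableSet_truncSet μ n))
        (fun a x => min (lam a x) n) =
      ∫⁻ x, (Set.univ.pi fun _ : V => H.truncSet μ n).indicator (fun x =>
        (∏ e ∈ G.edgeFinset, (H.edgeWeight x e : ℝ≥0∞)) *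
          ∏ a, ((min (lam a (x a)) n : ℝ≥0) : ℝ≥0∞)) x ∂Measure.pi fun _ : V => μ := by
  have hS : MeasurableSet (Set.univ.pi fun _ : V => H.truncSet μ n) :=
    MeasurableSet.univ_pi fun _ => H.measurableSet_truncSet μ n
  rw [homWeighted, ← Measure.restrict_pi_pi, lintegral_indicator hS]
  refine setLIntegral_congr_fun hS fun x hx => ?_
  have hx' : ∀ a, x a ∈ H.truncSet μ n := fun a => hx a (Set.mem_univ a)
  congr 1
  refine Finset.prod_congr rfl fun e _ => ?_
  induction e with
  | _ a b => simp [edgeWeight_mk, restrict, hx' a, hx' b]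

theorem homWeighted_le_of_forall_truncation (μ : Measure Ω) [SigmaFinite μ]
    {lam : V → Ω → ℝ≥0} (hlam : ∀ a, Measurable (lam a)) {c : ℝ≥0∞}
    (h : ∀ n : ℕ, homWeighted (μ.restrict (H.truncSet μ n)) G
      (H.restrict (H.measurableSet_truncSet μ n)) (fun a x => min (lam a x) n) ≤ c) :
    homWeighted μ G H lam ≤ c := by
  set F : ℕ → (V → Ω) → ℝ≥0∞ := fun n =>
    (Set.univ.pi fun _ : V => H.truncSet μ n).indicator fun x =>
      (∏ e ∈ G.edgeFinset, (H.edgeWeight x e : ℝ≥0∞)) *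
        ∏ a, ((min (lam a (x a)) n : ℝ≥0) : ℝ≥0∞) with hF
  have hlim : ∀ x, Filter.Tendsto (fun n => F n x) Filter.atTop
      (nhds ((∏ e ∈ G.edgeFinset, (H.edgeWeight x e : ℝ≥0∞)) * ∏ a, (lam a (x a) : ℝ≥0∞))) := by
    intro x
    -- For each coloring the truncated integrand is eventually equal to the full one, since only
    -- finitely many colors are involved.
    refine tendsto_const_nhds.congr' ?_
    have h1 : ∀ᶠ n in Filter.atTop, ∀ a, x a ∈ H.truncSet μ n :=
      Filter.eventually_all.2 fun a => H.eventually_mem_truncSet μ (x a)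
    have h2 : ∀ᶠ n : ℕ in Filter.atTop, ∀ a, lam a (x a) ≤ n :=
      Filter.eventually_all.2 fun a => by
        obtain ⟨m, hm⟩ := exists_nat_ge (lam a (x a))
        filter_upwards [Filter.eventually_ge_atTop m] with n hn
        exact hm.trans (by exact_mod_cast hn)
    filter_upwards [h1, h2] with n hn1 hn2
    rw [hF]
    simp only
    rw [Set.indicator_of_mem (Set.mem_univ_pi.2 hn1)]
    simp only [min_eq_left (hn2 _)]
  have hmono : ∀ x, Monotone fun n => F n x := by
    intro x m n hmn
    simp only [hF]
    by_cases hx : x ∈ Set.univ.pi fun _ : V => H.truncSet μ m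
    · rw [Set.indicator_of_mem hx,
        Set.indicator_of_mem (Set.pi_mono (fun _ _ => H.monotone_truncSet μ hmn) hx)]
      gcongr
    · rw [Set.indicator_of_notMem hx]
      exact zero_le
  have hmeas : ∀ n, Measurable (F n) := fun n => by
    refine Measurable.indicator ?_ (MeasurableSet.univ_pi fun _ => H.measurableSet_truncSet μ n)
    refine (Finset.measurable_fun_prod _ fun e _ =>
      (measurable_edgeWeight H e).coe_nnreal_ennreal).mul
      (Finset.measurable_fun_prod _ fun a _ => Measurable.coe_nnreal_ennreal ?_)
    exact ((hlam a).comp (measurable_pi_apply a)).min measurable_const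
  refine le_of_tendsto' (lintegral_tendsto_of_tendsto_of_monotone
    (fun n => (hmeas n).aemeasurable) (Filter.Eventually.of_forall hmono)
    (Filter.Eventually.of_forall hlim)) fun n => ?_
  rw [← homWeighted_truncation]
  exact h n

theorem IsPosSemidef.homWeighted_le {H : WeightedGraph Ω} (hH : H.IsPosSemidef) (μ : Measure Ω)
    [SigmaFinite μ] {lam : V → Ω → ℝ≥0} (hlam : ∀ a, Measurable (lam a)) :
    homWeighted μ G H lam ≤ ∏ a : V,
      homWeighted μ (⊤ : SimpleGraph (Fin (G.degree a + 1))) H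
        (fun _ => lam a) ^ (1 / ((G.degree a : ℝ) + 1)) := by
  refine homWeighted_le_of_forall_truncation G H μ hlam fun n => ?_
  have : IsFiniteMeasure (μ.restrict (H.truncSet μ n)) :=
    ⟨by
      rw [Measure.restrict_apply_univ]
      exact (measure_mono Set.inter_subset_left).trans_lt (measure_spanningSets_lt_top μ n)⟩
  refine (homWeighted_restrict_le G H hH _ _ (C := n) (fun x hx => hx.2)
    (fun a => (hlam a).min measurable_const) fun a x => min_le_right _ _).trans ?_
  -- Truncation only decreases clique integrals, so the right side needs no limit.
  refine Finset.prod_le_prod' fun a _ => ?_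
  rw [homWeighted_top μ H _ (hlam a), ← Nat.cast_add_one]
  exact cliqueRoot_mono Measure.restrict_le_self (H.restrict_kernel_le _) _
    fun x => ENNReal.coe_le_coe.2 (min_le_left _ _)

theorem homWeighted_one (μ : Measure Ω) : homWeighted μ G H (fun _ _ => 1) = hom μ G H := by
  simp [homWeighted, hom]

theorem IsPosSemidef.isCliqueMaximizing {H : WeightedGraph Ω} (hH : H.IsPosSemidef)
    (μ : Measure Ω) [SigmaFinite μ] : IsCliqueMaximizing.{u, v} μ H := by
  intro V _ G _
  simpa only [homWeighted_one] using
    hH.homWeighted_le G μ (lam := fun _ _ => 1) fun _ => measurable_const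

theorem IsCliqueMaximizing.hom_rpow_le {μ : Measure Ω} {H : WeightedGraph Ω}
    (hH : IsCliqueMaximizing.{u, v} μ H) [Nonempty V] {d : ℕ} (hG : G.IsRegularOfDegree d) :
    hom μ G H ^ (1 / (Fintype.card V : ℝ)) ≤
      hom μ (⊤ : SimpleGraph (Fin (d + 1))) H ^ (1 / ((d : ℝ) + 1)) := by
  have hc : (Fintype.card V : ℝ) ≠ 0 := by exact_mod_cast Fintype.card_ne_zero
  have h := hH V G
  have e : ∀ a, hom μ (⊤ : SimpleGraph (Fin (G.degree a + 1))) H ^ (1 / ((G.degree a : ℝ) + 1)) =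
      hom μ (⊤ : SimpleGraph (Fin (d + 1))) H ^ (1 / ((d : ℝ) + 1)) := fun a => by
    rw [hG a]
  rw [Finset.prod_congr rfl fun a _ => e a, Finset.prod_const, Finset.card_univ] at h
  refine (ENNReal.rpow_le_rpow h (by positivity)).trans (le_of_eq ?_)
  rw [← ENNReal.rpow_natCast_mul, mul_one_div_cancel hc, ENNReal.rpow_one]

end WeightedGraph

theorem mainTheorem7 {Ω : Type v} [MeasurableSpace Ω] (μ : Measure Ω) [SigmaFinite μ]
    (H : WeightedGraph Ω) (hH : H.IsPosSemidef) :
    (∀ (V : Type u) [Fintype V] (G : SimpleGraph V) [DecidableRel G.Adj]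
        (lam : V → Ω → ℝ≥0), (∀ a, Measurable (lam a)) →
      WeightedGraph.homWeighted μ G H lam ≤ ∏ a : V,
        WeightedGraph.homWeighted μ (⊤ : SimpleGraph (Fin (G.degree a + 1))) H
          (fun _ => lam a) ^ (1 / ((G.degree a : ℝ) + 1))) ∧
    WeightedGraph.IsCliqueMaximizing.{u, v} μ H ∧
    (∀ d : ℕ,
      (⊤ : SimpleGraph (Fin (d + 1))).IsRegularOfDegree d ∧
      ∀ (V : Type u) [Fintype V] [Nonempty V] (G : SimpleGraph V) [DecidableRel G.Adj],
        G.IsRegularOfDegree d →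
        WeightedGraph.hom μ G H ^ (1 / (Fintype.card V : ℝ)) ≤
          WeightedGraph.hom μ (⊤ : SimpleGraph (Fin (d + 1))) H ^ (1 / ((d : ℝ) + 1))) := by
  refine ⟨fun V _ G _ lam hlam => hH.homWeighted_le G μ hlam, hH.isCliqueMaximizing μ,
    fun d => ⟨fun a => ?_, fun V _ _ G _ hG => (hH.isCliqueMaximizing μ).hom_rpow_le G hG⟩⟩
  simp
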